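/- Let $a,b$ be positive integers. In the $d$-diameter game $\mathcal D_d(a:b)$ on the edge set of the complete graph $K_n$, two players, Maker and Breaker, alternately claim previously unclaimed edges, Maker moving first. In each turn Maker claims $a$ edges and Breaker claims $b$ edges (or all remaining edges, if fewer are left), until all edges are claimed. Maker wins if the graph on the $n$ vertices formed by his edges has diameter at most $d$ (in particular is connected); otherwise Breaker wins. A player "wins the game" if that player has a winning strategy. For a real number $\beta\ge 1$, $\mathcal D_d(a:\beta)$ means $\mathcal D_d(a:\lfloor \beta\rfloor)$. **Theorem.** Let $d\ge 3$ be a fixed integer. 1. For all sufficiently large $n$ (depending on $d$), Maker wins the game $\mathcal D_d\bigl(1:(2d)^{-1}(n/\ln n)^{1-1/\lceil d/2\rceil}\bigr)$. 2. There is a constant $c_2=c_2(d)>0$ such that, for all sufficiently large $n$, Breaker wins the game $\mathcal D_d\bigl(1:c_2\,n^{1-1/(d-1)}\bigr)$. 3. For every integer $a>1$ there is a constant $c_3=c_3(a,d)>0$ such that, for all sufficiently large $n$, Breaker wins the game $\mathcal D_d\bigl(a:c_3\,n^{1-1/d}\bigr)$. -/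

import Mathlib

/-! Biased Maker-Breaker positional games, and the diameter game on the complete graph. -/

namespace MakerBreaker

variable {α : Type*} [DecidableEq α]

/-- The elements of the board that are still free when Maker owns `M` and Breaker owns `B`. -/
def free (board M B : Finset α) : Finset α := board \ (M ∪ B)

/-- `S` is a legal turn for a player with bias `q` when `U` is the set of free elements: the player
takes exactly `q` free elements, or all of them if fewer than `q` are left. -/
def IsTurn (q : ℕ) (U S : Finset α) : Prop := S ⊆ U ∧ S.card = min q U.card

/-- Maker has a winning strategy in the `(a:b)`-game from the position in which Maker owns `M`,
Breaker owns `B`, and it is Maker's turn. The game is played until the board is exhausted, and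
Maker wins iff his final set has the property `P`. A derivation of this predicate is a winning
strategy: in each round it prescribes a turn `S` of Maker, and goes on after every answer `T` of
Breaker. -/
inductive MakerWinsFrom (board : Finset α) (P : Finset α → Prop) (a b : ℕ) :
    Finset α → Finset α → Prop
  | finished (M B : Finset α) (hfree : free board M B = ∅) (hP : P M) :
      MakerWinsFrom board P a b M B
  | round (M B S : Finset α) (hfree : free board M B ≠ ∅) (hS : IsTurn a (free board M B) S)
      (hT : ∀ T : Finset α, IsTurn b (free board (M ∪ S) B) T →
        MakerWinsFrom board P a b (M ∪ S) (B ∪ T)) :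
      MakerWinsFrom board P a b M B

/-- Breaker has a winning strategy in the `(a:b)`-game from the position in which Maker owns `M`,
Breaker owns `B`, and it is Maker's turn: in each round a derivation prescribes an answer
`answer S` of Breaker to every turn `S` of Maker, and at the end Maker's set fails `P`. -/
inductive BreakerWinsFrom (board : Finset α) (P : Finset α → Prop) (a b : ℕ) :
    Finset α → Finset α → Prop
  | finished (M B : Finset α) (hfree : free board M B = ∅) (hP : ¬ P M) :
      BreakerWinsFrom board P a b M B
  | round (M B : Finset α) (answer : Finset α → Finset α) (hfree : free board M B ≠ ∅)
      (hT : ∀ S : Finset α, IsTurn a (free board M B) S →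
        IsTurn b (free board (M ∪ S) B) (answer S))
      (hS : ∀ S : Finset α, IsTurn a (free board M B) S →
        BreakerWinsFrom board P a b (M ∪ S) (B ∪ answer S)) :
      BreakerWinsFrom board P a b M B

/-- The board of the graph games: the edges of the complete graph on `n` vertices. -/
def completeBoard (n : ℕ) : Finset (Sym2 (Fin n)) := (⊤ : SimpleGraph (Fin n)).edgeFinset

/-- The graph on `n` vertices with edge set `M` has diameter at most `d`. The extended diameter of
a disconnected graph is `⊤`. -/
def DiamAtMost (d n : ℕ) (M : Finset (Sym2 (Fin n))) : Prop :=
  (SimpleGraph.fromEdgeSet (M : Set (Sym2 (Fin n)))).ediam ≤ (d : ℕ∞)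

/-- Maker, who moves first, wins the `(a:b)` `d`-diameter game on the complete graph on `n`
vertices. -/
def MakerWinsDiameter (d a b n : ℕ) : Prop :=
  MakerWinsFrom (completeBoard n) (DiamAtMost d n) a b ∅ ∅

/-- Breaker, who moves second, wins the `(a:b)` `d`-diameter game on the complete graph on `n`
vertices. -/
def BreakerWinsDiameter (d a b n : ℕ) : Prop :=
  BreakerWinsFrom (completeBoard n) (DiamAtMost d n) a b ∅ ∅

end MakerBreaker

/-! Breaker's strategies rest on degree control. If he answers every Maker edge with `q` edges at
each of its endpoints, Maker's degrees stay near `n / q` (`DegreeInv.exists_answer`), so a ball of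
radius `i` has at most about `(n / q) ^ i` vertices. For `q` a large multiple of `n ^ (1 - 1/d)` a
ball of radius `d` misses some vertex. This works against any fixed `a` and gives the third claim.

Against `a = 1` Breaker needs less: he protects one pair `x, y`, keeping the invariant that no
single unowned edge completes a walk of length at most `d = r + 2` between them. After Maker's edge
`e`, a new threat `f` must lie on such a walk together with `e`. The other edges number at most `r`,
so `f` joins vertices at total distance at most `r` from an endpoint of `e` and from `x` or `y`.
There are `O(D ^ r)` such edges when degrees are at most `D`, and Breaker takes them all. With bias
of order `n ^ (1 - 1/(r + 1))` both `q` and `D ^ r` are affordable.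

Maker plays a potential strategy (`makerWinsFrom_of_sum_weight_lt`) that collects many edges of
every star, an edge leaving every set of prescribed size outside any given set about `x` times
larger, and an edge between any two disjoint sets of the last size. Here `n = x ^ (j + 2) * log n`
with `j + 2 = ⌈d / 2⌉`. Balls then grow by a factor `x` per step up to `x ^ (j + 1) * log n`
vertices at radius `j + 1`, and two such balls meet or are joined by an edge, so distances are at
most `2 * j + 3 ≤ d`. -/

namespace MakerBreaker

/-! ### Strategies from invariants. -/

section Games

variable {α : Type*}

/-- Any small set of free elements can be completed to a legal turn. -/
theorem exists_isTurn_superset {U T : Finset α} {b : ℕ} (hT : T ⊆ U) (hb : T.card ≤ b) :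
    ∃ T', T ⊆ T' ∧ IsTurn b U T' := by
  obtain ⟨T', h1, h2, h3⟩ := Finset.exists_subsuperset_card_eq hT
    (le_min hb (Finset.card_le_card hT)) (min_le_right b U.card)
  exact ⟨T', h1, h2, h3⟩

variable [DecidableEq α]

theorem free_subset_free {board M B M' B' : Finset α} (hM : M ⊆ M') (hB : B ⊆ B') :
    free board M' B' ⊆ free board M B :=
  Finset.sdiff_subset_sdiff le_rfl (Finset.union_subset_union hM hB)

theorem mem_free {board M B : Finset α} {e : α} :
    e ∈ free board M B ↔ e ∈ board ∧ e ∉ M ∧ e ∉ B := by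
  simp [free]

/-- Termination measure for both invariant principles. -/
theorem card_free_lt {board M B S T : Finset α} {a : ℕ} (ha : 0 < a)
    (hfree : free board M B ≠ ∅) (hS : IsTurn a (free board M B) S) :
    (free board (M ∪ S) (B ∪ T)).card < (free board M B).card := by
  apply Finset.card_lt_card
  refine ⟨free_subset_free Finset.subset_union_left Finset.subset_union_left, fun h => ?_⟩
  have hpos : 0 < S.card := by
    rw [hS.2]
    exact lt_min ha (Finset.card_pos.2 (Finset.nonempty_iff_ne_empty.2 hfree))
  obtain ⟨e, he⟩ := Finset.card_pos.1 hpos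
  have := h (hS.1 he)
  rw [mem_free] at this
  exact this.2.1 (Finset.mem_union_right _ he)

/-- Breaker wins if he can maintain an invariant which at the end of the game refutes `P`. -/
theorem breakerWinsFrom_of_invariant {board : Finset α} {P : Finset α → Prop} {a b : ℕ}
    (ha : 0 < a) (Inv : Finset α → Finset α → Prop)
    (hend : ∀ M B, Inv M B → free board M B = ∅ → ¬ P M)
    (hstep : ∀ M B S, Inv M B → free board M B ≠ ∅ → IsTurn a (free board M B) S →
      ∃ T, IsTurn b (free board (M ∪ S) B) T ∧ Inv (M ∪ S) (B ∪ T)) (M B : Finset α)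
    (h : Inv M B) : BreakerWinsFrom board P a b M B := by
  classical
  induction hk : (free board M B).card using Nat.strong_induction_on generalizing M B with
  | _ k ih =>
    by_cases hfree : free board M B = ∅
    · exact .finished M B hfree (hend M B h hfree)
    -- `answer` must be a total function, so illegal turns `S` receive the dummy answer `∅`.
    · have key : ∀ S, ∃ T, IsTurn a (free board M B) S →
          IsTurn b (free board (M ∪ S) B) T ∧ Inv (M ∪ S) (B ∪ T) := by
        intro S
        by_cases hS : IsTurn a (free board M B) S
        · obtain ⟨T, hT⟩ := hstep M B S h hfree hS
          exact ⟨T, fun _ => hT⟩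
        · exact ⟨∅, fun h => absurd h hS⟩
      choose answer hans using key
      refine .round M B answer hfree (fun S hS => (hans S hS).1) fun S hS => ?_
      exact ih _ (hk ▸ card_free_lt ha hfree hS) _ _ (hans S hS).2 rfl

/-- Maker wins if he can maintain an invariant which at the end of the game implies `P`. -/
theorem makerWinsFrom_of_invariant {board : Finset α} {P : Finset α → Prop} {a b : ℕ}
    (ha : 0 < a) (Inv : Finset α → Finset α → Prop)
    (hend : ∀ M B, Inv M B → free board M B = ∅ → P M)
    (hstep : ∀ M B, Inv M B → free board M B ≠ ∅ → ∃ S, IsTurn a (free board M B) S ∧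
      ∀ T, IsTurn b (free board (M ∪ S) B) T → Inv (M ∪ S) (B ∪ T)) (M B : Finset α)
    (h : Inv M B) : MakerWinsFrom board P a b M B := by
  induction hk : (free board M B).card using Nat.strong_induction_on generalizing M B with
  | _ k ih =>
    by_cases hfree : free board M B = ∅
    · exact .finished M B hfree (hend M B h hfree)
    · obtain ⟨S, hS, hT⟩ := hstep M B h hfree
      exact .round M B S hfree hS fun T hTt =>
        ih _ (hk ▸ card_free_lt ha hfree hS) _ _ (hT T hTt) rfl

end Games

/-! ### Walks of bounded length, degrees and balls. -/

section Reach

variable {V : Type*}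

/-- `Reach M i x y`: the edges in `M` contain a walk of length at most `i` from `x` to `y`. -/
def Reach (M : Finset (Sym2 V)) : ℕ → V → V → Prop
  | 0, x, y => x = y
  | i + 1, x, y => Reach M i x y ∨ ∃ z, s(x, z) ∈ M ∧ Reach M i z y

namespace Reach

variable {M M' : Finset (Sym2 V)} {i j : ℕ} {x y z : V}

theorem refl (M : Finset (Sym2 V)) (i : ℕ) (x : V) : Reach M i x x := by
  induction i with
  | zero => rfl
  | succ i ih => exact Or.inl ih

theorem succ (h : Reach M i x y) : Reach M (i + 1) x y := Or.inl h

theorem cons (h : s(x, z) ∈ M) (h' : Reach M i z y) : Reach M (i + 1) x y := Or.inr ⟨z, h, h'⟩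

theorem mono (h : Reach M i x y) (hij : i ≤ j) : Reach M j x y := by
  induction hij with
  | refl => exact h
  | step _ ih => exact ih.succ

theorem mono_edges (h : Reach M i x y) (hM : M ⊆ M') : Reach M' i x y := by
  induction i generalizing x with
  | zero => exact h
  | succ i ih =>
    rcases h with h | ⟨z, hz, h⟩
    · exact (ih h).succ
    · exact cons (hM hz) (ih h)

theorem trans (h : Reach M i x y) (h' : Reach M j y z) : Reach M (i + j) x z := by
  induction i generalizing x with
  | zero => obtain rfl : x = y := h; exact h'.mono (by omega)
  | succ i ih =>
    rcases h with h | ⟨w, hw, h⟩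
    · exact (ih h).mono (by omega)
    · exact (cons hw (ih h)).mono (by omega)

theorem symm (h : Reach M i x y) : Reach M i y x := by
  induction i generalizing x with
  | zero => exact Eq.symm h
  | succ i ih =>
    rcases h with h | ⟨w, hw, h⟩
    · exact (ih h).succ
    · exact (ih h).trans (cons (Sym2.eq_swap ▸ hw) (refl M 0 x))

theorem edist_le (h : Reach M i x y) :
    (SimpleGraph.fromEdgeSet (M : Set (Sym2 V))).edist x y ≤ i := by
  induction i generalizing x with
  | zero => obtain rfl : x = y := h; simp
  | succ i ih =>
    rcases h with h | ⟨w, hw, h⟩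
    · exact (ih h).trans (by exact_mod_cast Nat.le_succ i)
    -- `M` may contain loops, which `SimpleGraph.fromEdgeSet` discards; such a step is skipped.
    · by_cases hxw : x = w
      · subst hxw
        exact (ih h).trans (by exact_mod_cast Nat.le_succ i)
      · have hadj : (SimpleGraph.fromEdgeSet (M : Set (Sym2 V))).Adj x w := by
          simp [hw, hxw]
        refine (SimpleGraph.edist_triangle (v := w)).trans ?_
        rw [SimpleGraph.edist_eq_one_iff_adj.2 hadj]
        push_cast
        rw [add_comm]
        gcongr
        exact ih h

theorem of_walk {G : SimpleGraph V} (hG : ∀ u v, G.Adj u v → s(u, v) ∈ M) (p : G.Walk x y) :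
    Reach M p.length x y := by
  induction p with
  | nil => rfl
  | cons h p ih => exact cons (hG _ _ h) ih

theorem of_edist_le
    (h : (SimpleGraph.fromEdgeSet (M : Set (Sym2 V))).edist x y ≤ i) : Reach M i x y := by
  obtain ⟨p, hp⟩ := SimpleGraph.exists_walk_of_edist_ne_top
    (ne_top_of_le_ne_top (ENat.natCast_ne_top i) h)
  rw [← hp] at h
  refine (of_walk (fun u v huv => ?_) p).mono (by exact_mod_cast h)
  simpa using (SimpleGraph.fromEdgeSet_adj _).1 huv |>.1

/-- A walk that uses a new edge `s(u, v)` splits there into two old walks. -/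
theorem of_insert [DecidableEq V] {u v : V} (h : Reach (insert s(u, v) M) i x y) :
    Reach M i x y ∨ ∃ p q, p + q + 1 ≤ i ∧
      ((Reach M p x u ∧ Reach M q v y) ∨ (Reach M p x v ∧ Reach M q u y)) := by
  induction i generalizing x with
  | zero => exact Or.inl h
  | succ i ih =>
    rcases h with h | ⟨w, hw, h⟩
    · rcases ih h with h | ⟨p, q, hpq, h⟩
      · exact Or.inl h.succ
      · exact Or.inr ⟨p, q, by omega, h⟩
    · rcases Finset.mem_insert.1 hw with hw | hw
      · rcases Sym2.eq_iff.1 hw with ⟨rfl, rfl⟩ | ⟨rfl, rfl⟩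
        · rcases ih h with h | ⟨p, q, hpq, ⟨h1, h2⟩ | ⟨h1, h2⟩⟩
          · exact Or.inr ⟨0, i, by omega, Or.inl ⟨rfl, h⟩⟩
          · exact Or.inr ⟨0, q, by omega, Or.inl ⟨rfl, h2⟩⟩
          · exact Or.inl (h2.mono (by omega))
        · rcases ih h with h | ⟨p, q, hpq, ⟨h1, h2⟩ | ⟨h1, h2⟩⟩
          · exact Or.inr ⟨0, i, by omega, Or.inr ⟨rfl, h⟩⟩
          · exact Or.inl (h2.mono (by omega))
          · exact Or.inr ⟨0, q, by omega, Or.inr ⟨rfl, h2⟩⟩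
      · rcases ih h with h | ⟨p, q, hpq, ⟨h1, h2⟩ | ⟨h1, h2⟩⟩
        · exact Or.inl (cons hw h)
        · exact Or.inr ⟨p + 1, q, by omega, Or.inl ⟨cons hw h1, h2⟩⟩
        · exact Or.inr ⟨p + 1, q, by omega, Or.inr ⟨cons hw h1, h2⟩⟩

end Reach

theorem diamAtMost_iff_forall_reach {d n : ℕ} {M : Finset (Sym2 (Fin n))} :
    DiamAtMost d n M ↔ ∀ x y, Reach M d x y := by
  refine ⟨fun h x y => .of_edist_le (SimpleGraph.edist_le_ediam.trans h), fun h => ?_⟩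
  exact SimpleGraph.ediam_le_of_edist_le fun x y => (h x y).edist_le

/-- The number of edges in `M` at the vertex `v`. -/
def degreeIn [DecidableEq V] (M : Finset (Sym2 V)) (v : V) : ℕ := (M.filter (v ∈ ·)).card

theorem card_neighbors_le_degreeIn [Fintype V] [DecidableEq V] (M : Finset (Sym2 V)) (v : V) :
    (Finset.univ.filter fun z => s(z, v) ∈ M).card ≤ degreeIn M v := by
  apply Finset.card_le_card_of_injOn (fun z => s(z, v))
  · intro z hz
    simpa using hz
  · intro z _ w _ h
    exact Sym2.congr_left.1 h

theorem degreeIn_union_le [DecidableEq V] (M S : Finset (Sym2 V)) (v : V) :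
    degreeIn (M ∪ S) v ≤ degreeIn M v + degreeIn S v := by
  unfold degreeIn
  rw [Finset.filter_union]
  exact Finset.card_union_le _ _

theorem degreeIn_le_card [Fintype V] [DecidableEq V] (M : Finset (Sym2 V)) (v : V) :
    degreeIn M v ≤ Fintype.card V := by
  rw [← Finset.card_univ]
  refine (Finset.card_le_card (t := Finset.univ.image fun z => s(v, z)) fun e he => ?_).trans
    Finset.card_image_le
  obtain ⟨w, rfl⟩ := (Finset.mem_filter.1 he).2
  exact Finset.mem_image_of_mem _ (Finset.mem_univ w)

theorem sum_degreeIn_le [Fintype V] [DecidableEq V] (S : Finset (Sym2 V)) :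
    ∑ v, degreeIn S v ≤ 2 * S.card := by
  have : ∑ v, degreeIn S v = ∑ e ∈ S, (Finset.univ.filter fun v => v ∈ e).card := by
    unfold degreeIn
    exact Finset.sum_card_bipartiteAbove_eq_sum_card_bipartiteBelow (fun v e => v ∈ e)
  rw [this, mul_comm]
  refine Finset.sum_le_card_nsmul _ _ _ fun e _ => ?_
  induction e with
  | _ u v =>
    refine (Finset.card_le_card (t := {u, v}) fun w hw => ?_).trans Finset.card_le_two
    simpa using hw

open Classical in
/-- A ball of radius `i` has at most `(D + 1) ^ i` elements if all degrees are at most `D`. -/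
theorem card_reach_le [Fintype V] [DecidableEq V] {M : Finset (Sym2 V)} {D : ℕ}
    (hD : ∀ v, degreeIn M v ≤ D) (i : ℕ) (y : V) :
    (Finset.univ.filter fun x => Reach M i x y).card ≤ (D + 1) ^ i := by
  induction i with
  | zero =>
    refine (Finset.card_le_card (t := {y}) fun x hx => ?_).trans (by simp)
    exact Finset.mem_singleton.2 (Finset.mem_filter.1 hx).2
  | succ i ih =>
    set R := Finset.univ.filter fun x => Reach M i x y
    have hsub : (Finset.univ.filter fun x => Reach M (i + 1) x y) ⊆
        R ∪ R.biUnion fun v => Finset.univ.filter fun z => s(z, v) ∈ M := by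
      intro x hx
      rcases (Finset.mem_filter.1 hx).2 with h | ⟨z, hz, h⟩
      · exact Finset.mem_union_left _ (by simpa [R] using h)
      · refine Finset.mem_union_right _ (Finset.mem_biUnion.2 ⟨z, by simpa [R] using h, ?_⟩)
        simpa using hz
    calc _ ≤ _ := Finset.card_le_card hsub
      _ ≤ _ := Finset.card_union_le _ _
      _ ≤ R.card + R.card * D := by
          gcongr
          exact Finset.card_biUnion_le_card_mul _ _ _ fun v _ =>
            (card_neighbors_le_degreeIn M v).trans (hD v)
      _ = R.card * (D + 1) := by ring
      _ ≤ (D + 1) ^ (i + 1) := by rw [pow_succ]; gcongr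

end Reach

/-! ### Breaker controls Maker's degrees. -/

section DegreeGame

variable {V : Type*} [Fintype V] [DecidableEq V]

/-- At every vertex, Breaker has `q` times as many edges as Maker, or the vertex has no free edge
left and the degree of Maker is small. -/
def DegreeInv (board : Finset (Sym2 V)) (q a : ℕ) (M B : Finset (Sym2 V)) : Prop :=
  ∀ v, q * degreeIn M v ≤ degreeIn B v ∨
    ((∀ e ∈ free board M B, v ∉ e) ∧ q * degreeIn M v ≤ Fintype.card V + q * a)

theorem degreeInv_empty (board : Finset (Sym2 V)) (q a : ℕ) : DegreeInv board q a ∅ ∅ :=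
  fun v => Or.inl (by simp [degreeIn])

theorem DegreeInv.mul_degreeIn_le {board M B : Finset (Sym2 V)} {q a : ℕ}
    (h : DegreeInv board q a M B) (v : V) : q * degreeIn M v ≤ Fintype.card V + q * a := by
  rcases h v with h | h
  · exact (h.trans (degreeIn_le_card B v)).trans (Nat.le_add_right _ _)
  · exact h.2

/-- At each vertex `v` Breaker takes `q` edges per new Maker edge at `v`; each edge has at most two
endpoints, so `2 * a * q` suffice. If too few edges are free at `v`, he takes all of them and the
degree is frozen: it exceeds the last controlled value by at most `a`. Allowing any larger `T'` lets
him use the rest of his turn freely. -/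
theorem DegreeInv.exists_answer {board M B S : Finset (Sym2 V)} {q a : ℕ}
    (h : DegreeInv board q a M B) (hS : S ⊆ free board M B) (ha : S.card ≤ a) :
    ∃ T ⊆ free board (M ∪ S) B, T.card ≤ 2 * a * q ∧
      ∀ T', T ⊆ T' → T' ⊆ free board (M ∪ S) B → DegreeInv board q a (M ∪ S) (B ∪ T') := by
  set U := free board (M ∪ S) B with hU
  have hex : ∀ v, ∃ T ⊆ U.filter (v ∈ ·), T.card = min (q * degreeIn S v)
      (U.filter (v ∈ ·)).card := fun v => Finset.exists_subset_card_eq (min_le_right _ _)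
  choose T hTU hTc using hex
  refine ⟨Finset.univ.biUnion T, ?_, ?_, ?_⟩
  · exact Finset.biUnion_subset.2 fun v _ => (hTU v).trans (Finset.filter_subset _ _)
  · calc (Finset.univ.biUnion T).card ≤ ∑ v, (T v).card := Finset.card_biUnion_le
      _ ≤ ∑ v, q * degreeIn S v := Finset.sum_le_sum fun v _ => by
          rw [hTc]; exact min_le_left _ _
      _ = q * ∑ v, degreeIn S v := by rw [Finset.mul_sum]
      _ ≤ q * (2 * a) := by
          gcongr
          exact (sum_degreeIn_le S).trans (by gcongr)
      _ = 2 * a * q := by ring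
  · intro T' hT' hT'U v
    have hTv : T v ⊆ T' := (Finset.subset_biUnion_of_mem T (Finset.mem_univ v)).trans hT'
    have hsub : free board (M ∪ S) (B ∪ T') ⊆ free board M B :=
      free_subset_free Finset.subset_union_left Finset.subset_union_left
    have hdeg := degreeIn_union_le M S v
    have hdegS : degreeIn S v ≤ a := (Finset.card_filter_le _ _).trans ha
    rcases h v with h | ⟨h1, h2⟩
    · rcases le_total (q * degreeIn S v) (U.filter (v ∈ ·)).card with hle | hle
      · left
        have hdisj : Disjoint B (T v) := by
          rw [Finset.disjoint_right]
          intro e he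
          have := (Finset.mem_filter.1 (hTU v he)).1
          exact (mem_free.1 this).2.2
        have h3 : degreeIn B v + (T v).card ≤ degreeIn (B ∪ T') v := by
          unfold degreeIn
          rw [← Finset.card_union_of_disjoint
            (hdisj.mono_left (Finset.filter_subset _ _))]
          refine Finset.card_le_card fun e he => ?_
          rcases Finset.mem_union.1 he with he | he
          · rw [Finset.mem_filter] at he ⊢
            exact ⟨Finset.mem_union_left _ he.1, he.2⟩
          · exact Finset.mem_filter.2 ⟨Finset.mem_union_right _ (hTv he),
              (Finset.mem_filter.1 (hTU v he)).2⟩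
        rw [hTc, min_eq_left hle] at h3
        calc q * degreeIn (M ∪ S) v ≤ q * (degreeIn M v + degreeIn S v) := by gcongr
          _ = q * degreeIn M v + q * degreeIn S v := by ring
          _ ≤ _ := by omega
      · right
        have hTeq : T v = U.filter (v ∈ ·) :=
          Finset.eq_of_subset_of_card_le (hTU v) (by rw [hTc, min_eq_right hle])
        refine ⟨fun e he hv => ?_, ?_⟩
        · rw [mem_free] at he
          have heU : e ∈ U := mem_free.2
            ⟨he.1, he.2.1, fun hB => he.2.2 (Finset.mem_union_left _ hB)⟩
          have : e ∈ T v := by rw [hTeq]; exact Finset.mem_filter.2 ⟨heU, hv⟩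
          exact he.2.2 (Finset.mem_union_right _ (hTv this))
        · calc q * degreeIn (M ∪ S) v ≤ q * (degreeIn M v + a) := by gcongr; omega
            _ = q * degreeIn M v + q * a := by ring
            _ ≤ _ := by
              gcongr
              exact h.trans (degreeIn_le_card B v)
    · right
      refine ⟨fun e he => h1 e (hsub he), ?_⟩
      have : degreeIn S v = 0 := by
        unfold degreeIn
        rw [Finset.card_eq_zero, Finset.filter_eq_empty_iff]
        exact fun e he => h1 e (hS he)
      rw [this, add_zero] at hdeg
      exact (Nat.mul_le_mul_left q hdeg).trans h2

end DegreeGame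

/-! ### Breaker against arbitrary `a`: balls too small to cover the vertices. -/

theorem mem_completeBoard {n : ℕ} {u v : Fin n} : s(u, v) ∈ completeBoard n ↔ u ≠ v := by
  simp [completeBoard]

/-- If Breaker keeps the degrees of Maker below `D`, and balls of radius `d` are then too small to
cover all vertices, Breaker wins. -/
theorem breakerWinsDiameter_of_pow_lt {d a b n q D : ℕ} (ha : 0 < a) (hn : 0 < n)
    (hq : 2 * a * q ≤ b) (hD : n + q * a < q * (D + 1)) (hpow : (D + 1) ^ d < n) :
    BreakerWinsDiameter d a b n := by
  classical
  refine breakerWinsFrom_of_invariant ha (DegreeInv (completeBoard n) q a) ?_ ?_ _ _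
    (degreeInv_empty _ _ _)
  · intro M B h _ hP
    rw [diamAtMost_iff_forall_reach] at hP
    have hdeg : ∀ v, degreeIn M v ≤ D := fun v => by
      have := h.mul_degreeIn_le v
      rw [Fintype.card_fin] at this
      exact Nat.lt_succ_iff.1 (Nat.lt_of_mul_lt_mul_left (this.trans_lt hD))
    have := card_reach_le hdeg d (⟨0, hn⟩ : Fin n)
    rw [Finset.filter_true_of_mem fun x _ => hP x _, Finset.card_univ, Fintype.card_fin] at this
    omega
  · intro M B S h _ hS
    obtain ⟨T, hTU, hTc, hT⟩ := h.exists_answer hS.1 (hS.2.trans_le (min_le_left _ _))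
    obtain ⟨T', hTT', hT'⟩ := exists_isTurn_superset hTU (hTc.trans hq)
    exact ⟨T', hT', hT T' hTT' hT'.1⟩

/-! ### Breaker against `a = 1`: separating two vertices. -/

/-- No walk of length at most `d` from `x` to `y` consists of edges of Maker and at most one edge
that Breaker does not own. -/
def SeparationInv {n : ℕ} (d : ℕ) (x y : Fin n) (M B : Finset (Sym2 (Fin n))) : Prop :=
  ¬ Reach M d x y ∧ ∀ f ∈ completeBoard n, f ∉ B → ¬ Reach (insert f M) d x y

open Classical in
/-- Edges between a vertex near `s` and a vertex near `t`. -/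
noncomputable def nearEdges {V : Type*} [Fintype V] [DecidableEq V] (M : Finset (Sym2 V)) (r : ℕ) (s t : V) :
    Finset (Sym2 V) :=
  (Finset.range (r + 1)).biUnion fun i =>
    ((Finset.univ.filter fun w => Reach M i w s) ×ˢ
      (Finset.univ.filter fun z => Reach M (r - i) z t)).image fun p => s(p.1, p.2)

/-- The two balls have radii adding up to `r`, so each of the `r + 1` ways to split `r` gives at
most `(D + 1) ^ r` edges. -/
theorem card_nearEdges_le {V : Type*} [Fintype V] [DecidableEq V] {M : Finset (Sym2 V)} {D : ℕ}
    (hD : ∀ v, degreeIn M v ≤ D) (r : ℕ) (s t : V) :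
    (nearEdges M r s t).card ≤ (r + 1) * (D + 1) ^ r := by
  unfold nearEdges
  refine (Finset.card_biUnion_le_card_mul _ _ ((D + 1) ^ r) fun i hi => ?_).trans_eq (by simp)
  refine Finset.card_image_le.trans ?_
  rw [Finset.card_product]
  refine (Nat.mul_le_mul (card_reach_le hD i s) (card_reach_le hD (r - i) t)).trans_eq ?_
  rw [← pow_add]
  congr 1
  have := Finset.mem_range.1 hi
  omega

theorem mem_nearEdges {V : Type*} [Fintype V] [DecidableEq V] {M : Finset (Sym2 V)} {r i j : ℕ} {s t w z : V}
    (hw : Reach M i w s) (hz : Reach M j z t) (hij : i + j ≤ r) : s(w, z) ∈ nearEdges M r s t := by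
  classical
  unfold nearEdges
  refine Finset.mem_biUnion.2 ⟨i, Finset.mem_range.2 (by omega), Finset.mem_image.2
    ⟨(w, z), ?_, rfl⟩⟩
  simp only [Finset.mem_product, Finset.mem_filter, Finset.mem_univ, true_and]
  exact ⟨hw, hz.mono (by omega)⟩

/-- If `f` completes a walk from `x` to `y` together with a new edge `s(u, v)`, but not without
it, then `f` joins a vertex near `u` or `v` to a vertex near `x` or `y`. -/
theorem mem_nearEdges_of_reach {V : Type*} [Fintype V] [DecidableEq V] {M : Finset (Sym2 V)}
    {r : ℕ} {x y u v : V} {f : Sym2 V} (h1 : ¬ Reach (insert s(u, v) M) (r + 2) x y)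
    (h2 : ¬ Reach (insert f M) (r + 2) x y)
    (h3 : Reach (insert f (insert s(u, v) M)) (r + 2) x y) :
    f ∈ (nearEdges (insert s(u, v) M) r u x ∪ nearEdges (insert s(u, v) M) r u y) ∪
      (nearEdges (insert s(u, v) M) r v x ∪ nearEdges (insert s(u, v) M) r v y) := by
  have hsub : M ⊆ insert s(u, v) M := Finset.subset_insert _ _
  have key : ∀ w z p q, f = s(w, z) → p + q + 1 ≤ r + 2 → Reach (insert s(u, v) M) p x w →
      Reach (insert s(u, v) M) q z y →
      f ∈ (nearEdges (insert s(u, v) M) r u x ∪ nearEdges (insert s(u, v) M) r u y) ∪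
      (nearEdges (insert s(u, v) M) r v x ∪ nearEdges (insert s(u, v) M) r v y) := by
    intro w z p q hf hpq hp hq
    simp only [Finset.mem_union]
    -- The walk must use `s(u, v)` before or after `f`, else it contradicts `h2`. The piece between
    -- the two edges and the piece from `f` to `x` or `y` have total length at most `r`.
    rcases hp.of_insert with hp' | ⟨p1, q1, hle, ⟨-, h⟩ | ⟨-, h⟩⟩
    · rcases hq.of_insert with hq' | ⟨p1, q1, hle, ⟨h, -⟩ | ⟨h, -⟩⟩
      · refine absurd ?_ h2
        have e1 : Reach (insert f M) p x w := hp'.mono_edges (Finset.subset_insert _ _)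
        have e2 : Reach (insert f M) q z y := hq'.mono_edges (Finset.subset_insert _ _)
        exact (e1.trans (Reach.cons (by rw [hf]; exact Finset.mem_insert_self _ _) e2)).mono
          (by omega)
      · left; left
        rw [hf, Sym2.eq_swap (a := w) (b := z)]
        exact mem_nearEdges (h.mono_edges hsub) hp.symm (by omega)
      · right; left
        rw [hf, Sym2.eq_swap (a := w) (b := z)]
        exact mem_nearEdges (h.mono_edges hsub) hp.symm (by omega)
    · right; right
      rw [hf]
      exact mem_nearEdges (h.symm.mono_edges hsub) hq (by omega)
    · left; right
      rw [hf]
      exact mem_nearEdges (h.symm.mono_edges hsub) hq (by omega)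
  induction f with
  | _ w z =>
    rcases h3.of_insert with h3 | ⟨p, q, hpq, ⟨hp, hq⟩ | ⟨hp, hq⟩⟩
    · exact absurd h3 h1
    · exact key w z p q rfl hpq hp hq
    · exact key z w p q Sym2.eq_swap hpq hp hq

theorem Reach.eq_of_singleton {V : Type*} {e : Sym2 V} {i : ℕ} {x w : V}
    (h : Reach {e} i x w) (hx : x ∉ e) : x = w := by
  induction i with
  | zero => exact h
  | succ i ih =>
    rcases h with h | ⟨z, hz, -⟩
    · exact ih h
    · rw [Finset.mem_singleton] at hz
      exact absurd (hz ▸ Sym2.mem_mk_left x z) hx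

/-- Since `e` avoids `x` and `y`, a walk between them with one further edge `f` forces `f = s(x,
y)`, which Breaker owns. -/
theorem separationInv_of_first_edge {n d : ℕ} {x y : Fin n} {e : Sym2 (Fin n)}
    {B : Finset (Sym2 (Fin n))} (hxy : x ≠ y) (hx : x ∉ e) (hy : y ∉ e) (hB : s(x, y) ∈ B) :
    SeparationInv d x y {e} B := by
  refine ⟨fun h => hxy (h.eq_of_singleton hx), fun f _ hfB h => ?_⟩
  induction f with
  | _ w z =>
    rcases h.of_insert with h | ⟨p, q, -, ⟨hp, hq⟩ | ⟨hp, hq⟩⟩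
    · exact hxy (h.eq_of_singleton hx)
    · rw [← hp.eq_of_singleton hx, ← hq.symm.eq_of_singleton hy] at hfB
      exact hfB hB
    · rw [← hp.eq_of_singleton hx, ← hq.symm.eq_of_singleton hy, Sym2.eq_swap] at hfB
      exact hfB hB

/-- In the game with one edge per turn of Maker, Breaker keeps two vertices at distance more than
`r + 2` by keeping the degrees of Maker at most `D` and answering all threats. -/
theorem breakerWinsDiameter_one {r b n q D : ℕ} (hn : 4 ≤ n) (hD : n + 2 * q < q * (D + 1))
    (hb : 2 * q + 4 * ((r + 1) * (D + 1) ^ r) ≤ b) :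
    BreakerWinsDiameter (r + 2) 1 b n := by
  classical
  -- On the empty position no pair is separated, since the unowned edge `s(x, y)` is itself a
  -- threat; the pair is chosen after Maker's first edge.
  refine breakerWinsFrom_of_invariant one_pos (fun M B => DegreeInv (completeBoard n) q 1 M B ∧
    ((M = ∅ ∧ B = ∅) ∨ ∃ x y, SeparationInv (r + 2) x y M B)) ?_ ?_ _ _
    ⟨degreeInv_empty _ _ _, Or.inl ⟨rfl, rfl⟩⟩
  · rintro M B ⟨-, ⟨rfl, rfl⟩ | ⟨x, y, h⟩⟩ hfree hP
    · have : s((⟨0, by omega⟩ : Fin n), ⟨1, by omega⟩) ∈ free (completeBoard n) ∅ ∅ := by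
        rw [mem_free, mem_completeBoard]
        simp
      simp [hfree] at this
    · exact h.1 (diamAtMost_iff_forall_reach.1 hP x y)
  · rintro M B S ⟨hdeg, hInv⟩ hfree hS
    have hS1 : S.card = 1 := by
      have : 0 < (free (completeBoard n) M B).card :=
        Finset.card_pos.2 (Finset.nonempty_iff_ne_empty.2 hfree)
      rw [hS.2]
      omega
    obtain ⟨e, rfl⟩ := Finset.card_eq_one.1 hS1
    have he := hS.1 (Finset.mem_singleton_self e)
    obtain ⟨T, hTU, hTc, hT⟩ := hdeg.exists_answer hS.1 hS1.le
    suffices ∃ W ⊆ free (completeBoard n) (M ∪ {e}) B,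
        W.card ≤ 4 * ((r + 1) * (D + 1) ^ r) ∧ ∀ T', W ⊆ T' →
          ∃ x y, SeparationInv (r + 2) x y (M ∪ {e}) (B ∪ T') by
      obtain ⟨W, hWU, hWc, hW⟩ := this
      obtain ⟨T', hTT', hT'⟩ := exists_isTurn_superset (Finset.union_subset hTU hWU)
        ((Finset.card_union_le _ _).trans (by omega) : _ ≤ b)
      exact ⟨T', hT', hT T' (Finset.subset_union_left.trans hTT') hT'.1,
        Or.inr (hW T' (Finset.subset_union_right.trans hTT'))⟩
    rcases hInv with ⟨rfl, rfl⟩ | ⟨x, y, hsep⟩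
    · have hcard : 1 < (Finset.univ.filter fun v : Fin n => v ∉ e).card := by
        have h1 := Finset.card_filter_add_card_filter_not (s := (Finset.univ : Finset (Fin n)))
          (fun v => v ∈ e)
        have h2 : (Finset.univ.filter fun v : Fin n => v ∈ e).card ≤ 2 := by
          induction e with
          | _ u v =>
            refine (Finset.card_le_card (t := {u, v}) fun w hw => ?_).trans Finset.card_le_two
            simpa using hw
        rw [Finset.card_univ, Fintype.card_fin] at h1
        omega
      obtain ⟨x, hx, y, hy, hxy⟩ := Finset.one_lt_card.1 hcard
      simp only [Finset.mem_filter, Finset.mem_univ, true_and] at hx hy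
      refine ⟨{s(x, y)}, ?_, ?_, fun T' hT' => ⟨x, y, ?_⟩⟩
      · rw [Finset.singleton_subset_iff, mem_free, mem_completeBoard]
        refine ⟨hxy, ?_, by simp⟩
        intro h
        rw [Finset.empty_union, Finset.mem_singleton] at h
        exact hx (h ▸ Sym2.mem_mk_left x y)
      · rw [Finset.card_singleton]
        have : 0 < (r + 1) * (D + 1) ^ r := by positivity
        omega
      · rw [Finset.empty_union]
        exact separationInv_of_first_edge hxy hx hy
          (Finset.mem_union_right _ (hT' (Finset.mem_singleton_self _)))
    · have heM : M ∪ {e} = insert e M := by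
        rw [Finset.union_comm]; rfl
      rw [heM]
      rw [mem_free] at he
      have hno : ¬ Reach (insert e M) (r + 2) x y := hsep.2 e he.1 he.2.2
      refine ⟨(free (completeBoard n) (insert e M) B).filter
        fun f => Reach (insert f (insert e M)) (r + 2) x y, Finset.filter_subset _ _, ?_,
        fun T' hT' => ⟨x, y, hno, fun f hf hfB hreach => ?_⟩⟩
      -- Threats are counted after `e` but before Breaker's answer. This extra edge accounts for the
      -- second `q` in `hD`.
      · have hdeg' : ∀ v, degreeIn (insert e M) v ≤ D := fun v => by
          have h1 := hdeg.mul_degreeIn_le v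
          have h2 := degreeIn_union_le M {e} v
          have h3 : degreeIn {e} v ≤ 1 := (Finset.card_filter_le _ _).trans (by simp)
          rw [heM] at h2
          rw [Fintype.card_fin] at h1
          have h4 : q * degreeIn (insert e M) v < q * (D + 1) := by
            refine lt_of_le_of_lt ?_ hD
            calc q * degreeIn (insert e M) v ≤ q * (degreeIn M v + 1) := by gcongr; omega
              _ = q * degreeIn M v + q := by ring
              _ ≤ _ := by omega
          exact Nat.lt_succ_iff.1 (Nat.lt_of_mul_lt_mul_left h4)
        clear hTU hTc hT heM
        induction e with
        | _ u v =>
          have hsub : (free (completeBoard n) (insert s(u, v) M) B).filter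
              (fun f => Reach (insert f (insert s(u, v) M)) (r + 2) x y) ⊆
              (nearEdges (insert s(u, v) M) r u x ∪ nearEdges (insert s(u, v) M) r u y) ∪
              (nearEdges (insert s(u, v) M) r v x ∪ nearEdges (insert s(u, v) M) r v y) := by
            intro f hf
            rw [Finset.mem_filter, mem_free] at hf
            exact mem_nearEdges_of_reach hno (hsep.2 f hf.1.1 hf.1.2.2) hf.2
          have hc := card_nearEdges_le hdeg' r
          have h1 := hc u x
          have h2 := hc u y
          have h3 := hc v x
          have h4 := hc v y
          have := Finset.card_le_card hsub
          have := Finset.card_union_le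
            (nearEdges (insert s(u, v) M) r u x ∪ nearEdges (insert s(u, v) M) r u y)
            (nearEdges (insert s(u, v) M) r v x ∪ nearEdges (insert s(u, v) M) r v y)
          have := Finset.card_union_le
            (nearEdges (insert s(u, v) M) r u x) (nearEdges (insert s(u, v) M) r u y)
          have := Finset.card_union_le
            (nearEdges (insert s(u, v) M) r v x) (nearEdges (insert s(u, v) M) r v y)
          omega
      · rw [Finset.mem_union, not_or] at hfB
        by_cases hfM : f ∈ insert e M
        · rw [Finset.insert_eq_of_mem hfM] at hreach
          exact hno hreach
        · exact hfB.2 (hT' (Finset.mem_filter.2 ⟨mem_free.2 ⟨hf, hfM, hfB.1⟩, hreach⟩))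

/-! ### Asymptotic choice of Breaker's parameters. -/

open Filter in
theorem tendsto_natCast_rpow_one_div_atTop {m : ℕ} (hm : 0 < m) :
    Tendsto (fun n : ℕ => (n : ℝ) ^ (1 / (m : ℝ))) atTop atTop :=
  (tendsto_rpow_atTop (by positivity)).comp tendsto_natCast_atTop_atTop

theorem rpow_one_div_pow_self {z : ℝ} (hz : 0 ≤ z) {m : ℕ} (hm : m ≠ 0) :
    (z ^ (1 / (m : ℝ))) ^ m = z := by
  rw [one_div]
  exact Real.rpow_inv_natCast_pow hz hm

/-- With `y` the `(r + 1)`-st root of `z`, the estimates become polynomial in `y`: `z = y ^ (r + 1)`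
and the bias is a multiple of `y ^ r`. -/
theorem rpow_one_sub_one_div {z : ℝ} (hz : 0 ≤ z) (r : ℕ) :
    z ^ (1 - 1 / ((r + 1 : ℕ) : ℝ)) = (z ^ (1 / ((r + 1 : ℕ) : ℝ))) ^ r := by
  rw [← Real.rpow_natCast, ← Real.rpow_mul hz]
  congr 1
  push_cast
  field_simp
  ring

theorem breakerWinsDiameter_eventually {a d : ℕ} (ha : 0 < a) (hd : 0 < d) :
    ∃ c : ℝ, 0 < c ∧ ∃ N : ℕ, ∀ n : ℕ, N ≤ n →
      BreakerWinsDiameter d a ⌊c * (n : ℝ) ^ (1 - 1 / (d : ℝ))⌋₊ n := by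
  obtain ⟨r, rfl⟩ : ∃ r, d = r + 1 := ⟨d - 1, by omega⟩
  have hev := (tendsto_natCast_rpow_one_div_atTop hd).eventually_ge_atTop (4 * (a + 1) : ℝ)
  obtain ⟨N, hN⟩ := Filter.eventually_atTop.1 hev
  have ha' : (1 : ℝ) ≤ a := by exact_mod_cast ha
  -- This makes `q = b / (2 * a)` at least `4 * y ^ r` after rounding, hence `n / q ≤ y / 4`. As `a
  -- + 1 ≤ y / 4`, also `D + 1 < y` for `D = n / q + a`.
  refine ⟨16 * a, by positivity, N + 1, fun n hn => ?_⟩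
  have hy := hN n (by omega)
  rw [rpow_one_sub_one_div (Nat.cast_nonneg n)]
  have hyn := rpow_one_div_pow_self (Nat.cast_nonneg (α := ℝ) n) (Nat.succ_ne_zero r)
  rw [Nat.succ_eq_add_one] at hyn
  set y := (n : ℝ) ^ (1 / ((r + 1 : ℕ) : ℝ))
  set b := ⌊16 * a * y ^ r⌋₊
  have hy1 : 1 ≤ y := by nlinarith
  have hyr : 1 ≤ y ^ r := one_le_pow₀ hy1
  have hb : 16 * a * y ^ r < b + 1 := Nat.lt_floor_add_one _
  set q := b / (2 * a)
  have hq : (b : ℝ) < 2 * a * (q + 1) := by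
    exact_mod_cast Nat.lt_mul_div_succ b (by positivity)
  have hq4 : 4 * y ^ r ≤ q := by
    have h1 : 16 * a * y ^ r < 2 * a * (q + 2) := by nlinarith
    have h2 : 8 * y ^ r < q + 2 := by
      refine lt_of_mul_lt_mul_left (a := (2 * a : ℝ)) ?_ (by positivity)
      linarith
    linarith
  have hq0 : (0 : ℝ) < q := by linarith
  have hq0' : 0 < q := by exact_mod_cast hq0
  have hD : ((n / q : ℕ) : ℝ) ≤ y / 4 := by
    refine Nat.cast_div_le.trans ?_
    rw [div_le_iff₀ hq0, ← hyn, pow_succ]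
    nlinarith
  refine breakerWinsDiameter_of_pow_lt (q := q) (D := n / q + a) ha (by omega)
    (Nat.mul_div_le _ _) ?_ ?_
  · have := Nat.lt_mul_div_succ n hq0'
    calc n + q * a < q * (n / q + 1) + q * a := by omega
      _ = _ := by ring
  · have h1 : (((n / q + a + 1 : ℕ) : ℝ)) < y := by push_cast; linarith
    have h2 := pow_lt_pow_left₀ h1 (Nat.cast_nonneg _) (Nat.succ_ne_zero r)
    rw [Nat.succ_eq_add_one, hyn] at h2
    exact_mod_cast h2

theorem breakerWinsDiameter_one_eventually (r : ℕ) :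
    ∃ c : ℝ, 0 < c ∧ ∃ N : ℕ, ∀ n : ℕ, N ≤ n →
      BreakerWinsDiameter (r + 2) 1 ⌊c * (n : ℝ) ^ (1 - 1 / ((r + 1 : ℕ) : ℝ))⌋₊ n := by
  have hev := (tendsto_natCast_rpow_one_div_atTop r.succ_pos).eventually_ge_atTop (1 : ℝ)
  obtain ⟨N, hN⟩ := Filter.eventually_atTop.1 hev
  -- Half of the bias controls degrees (`2 * q ≤ b / 2`), half answers threats: `D + 1 ≤ 4 * y`
  -- gives `4 * (r + 1) * (4 * y) ^ r ≤ b / 2`. The summand `13` absorbs rounding and secures `q ≥ y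
  -- ^ r`.
  refine ⟨8 * (r + 1) * 4 ^ r + 13, by positivity, N + 4, fun n hn => ?_⟩
  have hy1 := hN n (by omega)
  rw [Nat.succ_eq_add_one] at hy1
  rw [rpow_one_sub_one_div (Nat.cast_nonneg n)]
  have hyn := rpow_one_div_pow_self (Nat.cast_nonneg (α := ℝ) n) (Nat.succ_ne_zero r)
  rw [Nat.succ_eq_add_one] at hyn
  set y := (n : ℝ) ^ (1 / ((r + 1 : ℕ) : ℝ))
  set b := ⌊(8 * (r + 1) * 4 ^ r + 13) * y ^ r⌋₊
  have hyr : 1 ≤ y ^ r := one_le_pow₀ hy1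
  have hb : (8 * (r + 1) * 4 ^ r + 13) * y ^ r < b + 1 := Nat.lt_floor_add_one _
  have hbig : 8 * (r + 1) * 4 ^ r * y ^ r + 12 * y ^ r ≤ b := by linarith
  set q := b / 4
  have hq : (b : ℝ) < 4 * (q + 1) := by
    exact_mod_cast Nat.lt_mul_div_succ b (by norm_num)
  have hq1 : y ^ r ≤ q := by
    have : 0 ≤ 8 * (r + 1 : ℝ) * 4 ^ r * y ^ r := by positivity
    linarith
  have hq0 : (0 : ℝ) < q := by linarith
  have hq0' : 0 < q := by exact_mod_cast hq0
  have hD : ((n / q : ℕ) : ℝ) ≤ y := by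
    refine Nat.cast_div_le.trans ?_
    rw [div_le_iff₀ hq0, ← hyn, pow_succ]
    nlinarith
  refine breakerWinsDiameter_one (q := q) (D := n / q + 2) (by omega) ?_ ?_
  · have := Nat.lt_mul_div_succ n hq0'
    calc n + 2 * q < q * (n / q + 1) + 2 * q := by omega
      _ = _ := by ring
  · have h1 : (((n / q + 2 + 1 : ℕ) : ℝ)) ≤ 4 * y := by push_cast; linarith
    have h2 := pow_le_pow_left₀ (Nat.cast_nonneg _) h1 r
    have h3 : 4 * ((r + 1) * ((n / q + 2 + 1 : ℕ) : ℝ) ^ r) ≤ b / 2 := by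
      rw [mul_pow] at h2
      have : (r + 1) * ((n / q + 2 + 1 : ℕ) : ℝ) ^ r ≤ (r + 1) * (4 ^ r * y ^ r) := by gcongr
      linarith
    have h4 : (2 * q : ℝ) ≤ b / 2 := by
      have : ((4 * q : ℕ) : ℝ) ≤ b := by exact_mod_cast Nat.mul_div_le b 4
      push_cast at this
      linarith
    have : (2 * q : ℝ) + 4 * ((r + 1) * ((n / q + 2 + 1 : ℕ) : ℝ) ^ r) ≤ b := by linarith
    exact_mod_cast this

/-! ### Maker's potential function. -/

section Potential

variable {α : Type*} [DecidableEq α]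

/-- The weight of the target `(A, m)`, in which Maker wants more than `m` elements of `A`. -/
noncomputable def weight (l : ℝ) (M B : Finset α) (F : Finset α × ℕ) : ℝ :=
  2 ^ F.2 / l ^ (F.1.card - F.2) * (l ^ (F.1 ∩ B).card / 2 ^ (F.1 ∩ M).card)

/-- The total weight of the targets containing the element `e`. -/
noncomputable def elementWeight (l : ℝ) (I : Finset (Finset α × ℕ)) (M B : Finset α) (e : α) : ℝ :=
  ∑ F ∈ I with e ∈ F.1, weight l M B F

variable {l : ℝ} {I : Finset (Finset α × ℕ)} {M B : Finset α} {e : α}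

theorem weight_nonneg (hl : 1 ≤ l) (M B : Finset α) (F : Finset α × ℕ) : 0 ≤ weight l M B F := by
  unfold weight
  positivity

theorem weight_insert_maker (F : Finset α × ℕ) (he : e ∉ M) :
    weight l (insert e M) B F = weight l M B F - if e ∈ F.1 then weight l M B F / 2 else 0 := by
  unfold weight
  split_ifs with h
  · rw [Finset.inter_insert_of_mem h, Finset.card_insert_of_notMem (by simp [he]), pow_succ]
    field_simp
    ring
  · rw [Finset.inter_insert_of_notMem h, sub_zero]

theorem weight_insert_breaker (F : Finset α × ℕ) (he : e ∉ B) :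
    weight l M (insert e B) F =
      weight l M B F + if e ∈ F.1 then (l - 1) * weight l M B F else 0 := by
  unfold weight
  split_ifs with h
  · rw [Finset.inter_insert_of_mem h, Finset.card_insert_of_notMem (by simp [he]), pow_succ]
    ring
  · rw [Finset.inter_insert_of_notMem h, add_zero]

theorem weight_maker_le (hl : 1 ≤ l) (F : Finset α × ℕ) (he : e ∉ M) :
    weight l (insert e M) B F ≤ weight l M B F := by
  rw [weight_insert_maker F he]
  have := weight_nonneg hl M B F
  split_ifs <;> linarith

theorem weight_breaker_le (hl : 1 ≤ l) (F : Finset α × ℕ) (he : e ∉ B) :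
    weight l M (insert e B) F ≤ l * weight l M B F := by
  rw [weight_insert_breaker F he]
  have := weight_nonneg hl M B F
  split_ifs <;> nlinarith

theorem sum_weight_insert_maker (he : e ∉ M) :
    ∑ F ∈ I, weight l (insert e M) B F =
      ∑ F ∈ I, weight l M B F - elementWeight l I M B e / 2 := by
  simp only [weight_insert_maker _ he, Finset.sum_sub_distrib, elementWeight, Finset.sum_filter,
    Finset.sum_div]
  congr 1
  refine Finset.sum_congr rfl fun F _ => ?_
  split_ifs <;> simp

theorem sum_weight_insert_breaker (he : e ∉ B) :
    ∑ F ∈ I, weight l M (insert e B) F =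
      ∑ F ∈ I, weight l M B F + (l - 1) * elementWeight l I M B e := by
  simp only [weight_insert_breaker _ he, Finset.sum_add_distrib, elementWeight, Finset.sum_filter,
    Finset.mul_sum]
  congr 1
  refine Finset.sum_congr rfl fun F _ => ?_
  split_ifs <;> simp

theorem elementWeight_union_le (hl : 1 ≤ l) (f : α) (T : Finset α) (hT : Disjoint B T) :
    elementWeight l I M (B ∪ T) f ≤ l ^ T.card * elementWeight l I M B f := by
  induction T using Finset.induction_on with
  | empty => simp
  | insert e T he ih =>
    rw [Finset.disjoint_insert_right] at hT
    have h := ih hT.2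
    have he' : e ∉ B ∪ T := by simp [he, hT.1]
    rw [Finset.union_insert, Finset.card_insert_of_notMem he, pow_succ]
    calc elementWeight l I M (insert e (B ∪ T)) f ≤ l * elementWeight l I M (B ∪ T) f := by
          unfold elementWeight
          rw [Finset.mul_sum]
          exact Finset.sum_le_sum fun F _ => weight_breaker_le hl F he'
      _ ≤ l * (l ^ T.card * elementWeight l I M B f) := by gcongr
      _ = _ := by ring

/-- Each earlier element of `T` multiplies a weight by at most `l`, so the element added after `k`
others costs at most `(l - 1) * l ^ k * W`; these costs telescope. -/
theorem sum_weight_union_le (hl : 1 ≤ l) {W : ℝ} (T : Finset α) (hT : Disjoint B T)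
    (hW : ∀ f ∈ T, elementWeight l I M B f ≤ W) :
    ∑ F ∈ I, weight l M (B ∪ T) F ≤ ∑ F ∈ I, weight l M B F + (l ^ T.card - 1) * W := by
  induction T using Finset.induction_on with
  | empty => simp
  | insert e T he ih =>
    rw [Finset.disjoint_insert_right] at hT
    have h := ih hT.2 fun f hf => hW f (Finset.mem_insert_of_mem hf)
    have he' : e ∉ B ∪ T := by simp [he, hT.1]
    rw [Finset.union_insert, Finset.card_insert_of_notMem he, sum_weight_insert_breaker he']
    have h1 := elementWeight_union_le (I := I) (M := M) hl e T hT.2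
    have h2 : elementWeight l I M (B ∪ T) e ≤ l ^ T.card * W :=
      h1.trans (by gcongr; exact hW e (Finset.mem_insert_self _ _))
    have h3 : (l - 1) * elementWeight l I M (B ∪ T) e ≤ (l - 1) * (l ^ T.card * W) :=
      mul_le_mul_of_nonneg_left h2 (by linarith)
    rw [pow_succ]
    linarith

/-- A biased Erdős–Selfridge criterion for Maker, who wants more than `m` elements of `A` for
every target `(A, m)`. -/
theorem makerWinsFrom_of_sum_weight_lt {board : Finset α} {P : Finset α → Prop} {b : ℕ}
    (hl : 1 ≤ l) (hlb : l ^ b ≤ 3 / 2) (hboard : ∀ F ∈ I, F.1 ⊆ board)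
    (hsum : ∑ F ∈ I, (2 : ℝ) ^ F.2 / l ^ (F.1.card - F.2) < 1)
    (hP : ∀ M ⊆ board, (∀ F ∈ I, F.2 < (F.1 ∩ M).card) → P M) :
    MakerWinsFrom board P 1 b ∅ ∅ := by
  refine makerWinsFrom_of_invariant one_pos
    (fun M B => M ⊆ board ∧ ∑ F ∈ I, weight l M B F < 1) ?_ ?_ _ _
    ⟨Finset.empty_subset _, by simpa [weight] using hsum⟩
  · rintro M B ⟨hM, hlt⟩ hfree
    refine hP M hM fun F hF => ?_
    by_contra! hle
    refine absurd hlt (not_lt.2 ?_)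
    refine le_trans ?_ (Finset.single_le_sum (fun F _ => weight_nonneg hl M B F) hF)
    -- On a full board a failed target leaves Breaker at least `|A| - m` elements, so its weight
    -- alone is at least `1`.
    have hcard : F.1.card - F.2 ≤ (F.1 ∩ B).card := by
      have h1 : F.1 ⊆ (F.1 ∩ M) ∪ (F.1 ∩ B) := by
        rw [← Finset.inter_union_distrib_left]
        exact Finset.subset_inter le_rfl
          ((hboard F hF).trans (Finset.sdiff_eq_empty_iff_subset.1 hfree))
      have h2 := (Finset.card_le_card h1).trans (Finset.card_union_le _ _)
      omega
    unfold weight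
    have h1 : l ^ (F.1.card - F.2) ≤ l ^ (F.1 ∩ B).card := pow_le_pow_right₀ hl hcard
    have h2 : (2 : ℝ) ^ (F.1 ∩ M).card ≤ 2 ^ F.2 := pow_le_pow_right₀ (by norm_num) hle
    have hl0 : 0 < l := by linarith
    rw [div_mul_div_comm, one_le_div (by positivity), mul_comm]
    gcongr
  · rintro M B ⟨hM, hlt⟩ hfree
    -- Maker takes an element of largest total weight `W`, gaining `W / 2`. Breaker's turn then adds
    -- at most `(l ^ b - 1) * W ≤ W / 2`, so the potential never rises over a round.
    obtain ⟨e, he, hmax⟩ := Finset.exists_max_image (free board M B)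
      (elementWeight l I M B) (Finset.nonempty_iff_ne_empty.2 hfree)
    have heM : M ∪ {e} = insert e M := by rw [Finset.union_comm]; rfl
    have he' := mem_free.1 he
    refine ⟨{e}, ⟨Finset.singleton_subset_iff.2 he, ?_⟩, fun T hT => ⟨?_, ?_⟩⟩
    · rw [Finset.card_singleton, eq_comm, min_eq_left_iff, Nat.one_le_iff_ne_zero,
        Finset.card_ne_zero]
      exact ⟨e, he⟩
    · exact Finset.union_subset hM (Finset.singleton_subset_iff.2 he'.1)
    · rw [heM] at hT ⊢
      have hdisj : Disjoint B T := by
        rw [Finset.disjoint_right]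
        exact fun f hf => (mem_free.1 (hT.1 hf)).2.2
      have h1 := sum_weight_union_le (I := I) (M := insert e M) (W := elementWeight l I M B e) hl T
        hdisj fun f hf => by
          have hf' := mem_free.1 (hT.1 hf)
          refine le_trans (Finset.sum_le_sum fun F _ => weight_maker_le hl F he'.2.1) (hmax f ?_)
          exact mem_free.2 ⟨hf'.1, fun h => hf'.2.1 (Finset.mem_insert_of_mem h), hf'.2.2⟩
      have h0 := sum_weight_insert_maker (l := l) (I := I) (B := B) he'.2.1
      have hnonneg : 0 ≤ elementWeight l I M B e :=
        Finset.sum_nonneg fun F _ => weight_nonneg hl M B F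
      have h2 : l ^ T.card ≤ 3 / 2 :=
        (pow_le_pow_right₀ hl (hT.2.trans_le (min_le_left _ _))).trans hlb
      nlinarith

end Potential

/-! ### Expansion implies small diameter. -/

section Expansion

variable {V : Type*} [Fintype V] [DecidableEq V]

/-- The edges between two sets of vertices. -/
def cross (S T : Finset V) : Finset (Sym2 V) := (S ×ˢ T).image fun p => s(p.1, p.2)

omit [Fintype V] in
theorem mem_cross {S T : Finset V} {e : Sym2 V} :
    e ∈ cross S T ↔ ∃ u ∈ S, ∃ v ∈ T, s(u, v) = e := by
  simp [cross, and_assoc]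

omit [Fintype V] in
theorem card_cross {S T : Finset V} (h : Disjoint S T) :
    (cross S T).card = S.card * T.card := by
  unfold cross
  rw [Finset.card_image_of_injOn, Finset.card_product]
  rintro ⟨u, v⟩ huv ⟨u', v'⟩ huv' heq
  simp only [Finset.coe_product, Set.mem_prod, Finset.mem_coe] at huv huv'
  rcases Sym2.eq_iff.1 heq with ⟨rfl, rfl⟩ | ⟨rfl, rfl⟩
  · rfl
  · exact absurd huv'.2 (Finset.disjoint_left.1 h huv.1)

theorem cross_subset_completeBoard {n : ℕ} {S T : Finset (Fin n)} (h : Disjoint S T) :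
    cross S T ⊆ completeBoard n := by
  intro e he
  obtain ⟨u, hu, v, hv, rfl⟩ := mem_cross.1 he
  rw [mem_completeBoard]
  rintro rfl
  exact Finset.disjoint_left.1 h hu hv

/-- Large degrees, expansion of sets of size `X ^ i * L`, and an edge between any two disjoint sets
of size `X ^ (k + 1) * L` give a small diameter. -/
theorem reach_of_expansion {M : Finset (Sym2 V)} {X L k : ℕ}
    (hX : ∀ i < k, (X + 1) * (X ^ (i + 1) * L) ≤ Fintype.card V)
    (hdeg : ∀ v, X * L < (cross {v} {v}ᶜ ∩ M).card)
    (hexp : ∀ i < k, ∀ S W : Finset V, S.card = X ^ (i + 1) * L → W.card = X ^ (i + 2) * L →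
      (cross S (S ∪ W)ᶜ ∩ M).Nonempty)
    (hedge : ∀ S T : Finset V, Disjoint S T → S.card = X ^ (k + 1) * L →
      T.card = X ^ (k + 1) * L → (cross S T ∩ M).Nonempty) (x y : V) :
    Reach M (2 * k + 3) x y := by
  have hball : ∀ i ≤ k, ∀ x, ∃ S : Finset V, S.card = X ^ (i + 1) * L ∧
      ∀ z ∈ S, Reach M (i + 1) x z := by
    intro i hi x
    induction i with
    | zero =>
      have hle : X ^ (0 + 1) * L ≤ (Finset.univ.filter fun z => s(x, z) ∈ M).card := by
        rw [zero_add, pow_one]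
        refine (hdeg x).le.trans ((Finset.card_le_card (t := (Finset.univ.filter
          fun z => s(x, z) ∈ M).image fun z => s(x, z)) fun e he => ?_).trans
          Finset.card_image_le)
        rw [Finset.mem_inter, mem_cross] at he
        obtain ⟨⟨u, hu, v, -, rfl⟩, he⟩ := he
        obtain rfl := Finset.mem_singleton.1 hu
        exact Finset.mem_image.2 ⟨v, by simpa using he, rfl⟩
      obtain ⟨S, hS, hc⟩ := Finset.exists_subset_card_eq hle
      refine ⟨S, hc, fun z hz => ?_⟩
      exact Reach.cons (Finset.mem_filter.1 (hS hz)).2 (Reach.refl M 0 z)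
    | succ i ih =>
      obtain ⟨S, hS, hr⟩ := ih (by omega)
      set N := Finset.univ.filter fun z => ∃ u ∈ S, s(u, z) ∈ M with hN
      have hle : X ^ (i + 1 + 1) * L ≤ N.card := by
        -- Too small a neighbourhood `N` would fit in a set `W` of size exactly `X ^ (i + 2) * L`;
        -- the edge leaving `S ∪ W` contradicts this.
        by_contra! hlt
        obtain ⟨W, hNW, -, hW⟩ := Finset.exists_subsuperset_card_eq (Finset.subset_univ N) hlt.le
          (by
            rw [Finset.card_univ]
            refine le_trans ?_ (hX i (by omega))
            rw [pow_succ _ (i + 1), mul_comm (X ^ (i + 1)) X, mul_assoc]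
            gcongr
            omega)
        obtain ⟨e, he⟩ := hexp i (by omega) S W hS hW
        rw [Finset.mem_inter, mem_cross] at he
        obtain ⟨⟨u, hu, v, hv, rfl⟩, he⟩ := he
        rw [Finset.mem_compl, Finset.mem_union, not_or] at hv
        exact hv.2 (hNW (by rw [hN, Finset.mem_filter]; exact ⟨Finset.mem_univ _, u, hu, he⟩))
      obtain ⟨S', hS', hc⟩ := Finset.exists_subset_card_eq hle
      refine ⟨S', hc, fun z hz => ?_⟩
      obtain ⟨u, hu, he⟩ := (Finset.mem_filter.1 (hS' hz)).2
      exact (hr u hu).trans (Reach.cons he (Reach.refl M 0 z))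
  obtain ⟨S, hS, hSr⟩ := hball k le_rfl x
  obtain ⟨T, hT, hTr⟩ := hball k le_rfl y
  by_cases hdisj : Disjoint S T
  · obtain ⟨e, he⟩ := hedge S T hdisj hS hT
    rw [Finset.mem_inter, mem_cross] at he
    obtain ⟨⟨u, hu, v, hv, rfl⟩, he⟩ := he
    exact ((hSr u hu).trans (Reach.cons he (hTr v hv).symm)).mono (by omega)
  · obtain ⟨z, hz, hz'⟩ := Finset.not_disjoint_iff.1 hdisj
    exact ((hSr z hz).trans (hTr z hz').symm).mono (by omega)

end Expansion

/-! ### Initial weights of Maker's three families of targets. -/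

section Targets

variable {n : ℕ}

/-- Every star, with threshold `m`. -/
def starTargets (n m : ℕ) : Finset (Finset (Sym2 (Fin n)) × ℕ) :=
  Finset.univ.image fun v => (cross {v} {v}ᶜ, m)

/-- The edges from a set of size `s` to the complement of its union with a set of size `t`. -/
def expansionTargets (n s t : ℕ) : Finset (Finset (Sym2 (Fin n)) × ℕ) :=
  (Finset.univ.powersetCard s ×ˢ Finset.univ.powersetCard t).image
    fun p => (cross p.1 (p.1 ∪ p.2)ᶜ, 0)

/-- The edges between two disjoint sets of size `s`. -/
def pairTargets (n s : ℕ) : Finset (Finset (Sym2 (Fin n)) × ℕ) :=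
  ((Finset.univ.powersetCard s ×ˢ Finset.univ.powersetCard s).filter
    fun p => Disjoint p.1 p.2).image fun p => (cross p.1 p.2, 0)

theorem sum_union_le_add {ι : Type*} [DecidableEq ι] {f : ι → ℝ} (hf : ∀ i, 0 ≤ f i)
    (A B : Finset ι) : ∑ i ∈ A ∪ B, f i ≤ ∑ i ∈ A, f i + ∑ i ∈ B, f i := by
  rw [← Finset.sum_union_inter]
  exact le_add_of_nonneg_right (Finset.sum_nonneg fun i _ => hf i)

theorem sum_biUnion_le_card_mul {ι κ : Type*} [DecidableEq ι] [DecidableEq κ] {f : ι → ℝ}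
    (hf : ∀ i, 0 ≤ f i) (K : Finset κ) (A : κ → Finset ι) {c : ℝ}
    (hc : ∀ k ∈ K, ∑ i ∈ A k, f i ≤ c) : ∑ i ∈ K.biUnion A, f i ≤ K.card * c := by
  induction K using Finset.induction_on with
  | empty => simp
  | insert k K hk ih =>
    rw [Finset.biUnion_insert, Finset.card_insert_of_notMem hk]
    have h1 := sum_union_le_add hf (A k) (K.biUnion A)
    have h2 := hc k (Finset.mem_insert_self _ _)
    have h3 := ih fun k' hk' => hc k' (Finset.mem_insert_of_mem hk')
    push_cast
    linarith

theorem card_powersetCard_le_exp {L : ℝ} (hn : (n : ℝ) = Real.exp L) (s : ℕ) :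
    (((Finset.univ : Finset (Fin n)).powersetCard s).card : ℝ) ≤ Real.exp (s * L) := by
  rw [Finset.card_powersetCard, Finset.card_univ, Fintype.card_fin, mul_comm, Real.exp_mul,
    ← hn, Real.rpow_natCast]
  exact_mod_cast Nat.choose_le_pow n s

/-- A union bound with `L = log n`: there are at most `n` stars, so weight `n ^ (-2)` each suffices.
The constant `7/10` bounds `log 2`. -/
theorem sum_starTargets_le {L c : ℝ} {m : ℕ} (hn : (n : ℝ) = Real.exp L) (hm : m + 1 ≤ n)
    (hc : 2 * L + m * (7 / 10) ≤ c * (n - (m + 1))) :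
    ∑ F ∈ starTargets n m, (2 : ℝ) ^ F.2 / Real.exp c ^ (F.1.card - F.2) ≤ Real.exp (-L) := by
  refine (Finset.sum_le_card_nsmul _ _ (Real.exp (-(2 * L))) ?_).trans ?_
  · intro F hF
    obtain ⟨v, -, rfl⟩ := Finset.mem_image.1 hF
    simp only
    rw [card_cross (by simp), Finset.card_singleton, one_mul, Finset.card_compl,
      Finset.card_singleton, Fintype.card_fin, ← Real.exp_nat_mul, Nat.sub_sub, add_comm 1 m,
      Nat.cast_sub hm]
    have h2 : (2 : ℝ) ^ m ≤ Real.exp (m * (7 / 10)) := by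
      rw [Real.exp_nat_mul]
      gcongr
      rw [← Real.log_le_iff_le_exp (by norm_num)]
      have := Real.log_two_lt_d9
      linarith
    rw [div_le_iff₀ (Real.exp_pos _), ← Real.exp_add]
    refine h2.trans (Real.exp_le_exp.2 ?_)
    push_cast
    linarith
  · have hcard : ((starTargets n m).card : ℝ) ≤ Real.exp L := by
      rw [← hn]
      exact_mod_cast Finset.card_image_le.trans_eq (by simp)
    rw [nsmul_eq_mul]
    calc _ ≤ Real.exp L * Real.exp (-(2 * L)) := by gcongr
      _ = Real.exp (-L) := by rw [← Real.exp_add]; congr 1; ring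

/-- At most `n ^ (s + t)` targets, each with at least `s * (n - (s + t))` edges; the spare `L` in
`hc` leaves a total of `1 / n`. -/
theorem sum_expansionTargets_le {L c : ℝ} {s t : ℕ} (hn : (n : ℝ) = Real.exp L) (hc0 : 0 ≤ c)
    (hc : (s + t) * L + L ≤ c * (s * (n - (s + t)))) :
    ∑ F ∈ expansionTargets n s t, (2 : ℝ) ^ F.2 / Real.exp c ^ (F.1.card - F.2) ≤
      Real.exp (-L) := by
  refine (Finset.sum_le_card_nsmul _ _ (Real.exp (-(c * (s * (n - (s + t)))))) ?_).trans ?_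
  · intro F hF
    obtain ⟨⟨S, W⟩, hp, rfl⟩ := Finset.mem_image.1 hF
    obtain ⟨hS, hW⟩ := Finset.mem_product.1 hp
    have hS := (Finset.mem_powersetCard.1 hS).2
    have hW := (Finset.mem_powersetCard.1 hW).2
    simp only at hS hW ⊢
    have hdisj : Disjoint S (S ∪ W)ᶜ := disjoint_compl_right.mono_left Finset.subset_union_left
    have hU : (S ∪ W).card ≤ s + t := hS ▸ hW ▸ Finset.card_union_le S W
    have hcompl : (n : ℝ) - (s + t) ≤ ((S ∪ W)ᶜ.card : ℝ) := by
      have h1 := Finset.card_compl_add_card (S ∪ W)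
      rw [Fintype.card_fin] at h1
      have : (n : ℝ) ≤ (S ∪ W)ᶜ.card + (s + t) := by exact_mod_cast (by omega)
      linarith
    rw [card_cross hdisj, hS, pow_zero, Nat.sub_zero, ← Real.exp_nat_mul, one_div, ← Real.exp_neg]
    refine Real.exp_le_exp.2 (neg_le_neg ?_)
    rw [mul_comm]
    push_cast
    gcongr
  · have hcard : ((expansionTargets n s t).card : ℝ) ≤ Real.exp ((s + t) * L) := by
      rw [add_mul, Real.exp_add]
      refine le_trans ?_ (mul_le_mul (card_powersetCard_le_exp hn s)
        (card_powersetCard_le_exp hn t) (by positivity) (by positivity))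
      exact_mod_cast Finset.card_image_le.trans_eq (Finset.card_product _ _)
    rw [nsmul_eq_mul]
    refine (mul_le_mul_of_nonneg_right hcard (Real.exp_pos _).le).trans ?_
    rw [← Real.exp_add]
    exact Real.exp_le_exp.2 (by linarith)

theorem sum_pairTargets_le {L c : ℝ} {s : ℕ} (hn : (n : ℝ) = Real.exp L)
    (hc : 2 * s * L + L ≤ c * (s * s)) :
    ∑ F ∈ pairTargets n s, (2 : ℝ) ^ F.2 / Real.exp c ^ (F.1.card - F.2) ≤ Real.exp (-L) := by
  refine (Finset.sum_le_card_nsmul _ _ (Real.exp (-(c * (s * s)))) ?_).trans ?_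
  · intro F hF
    obtain ⟨⟨S, T⟩, hp, rfl⟩ := Finset.mem_image.1 hF
    rw [Finset.mem_filter, Finset.mem_product] at hp
    obtain ⟨⟨hS, hT⟩, hdisj⟩ := hp
    have hS := (Finset.mem_powersetCard.1 hS).2
    have hT := (Finset.mem_powersetCard.1 hT).2
    simp only at hS hT hdisj ⊢
    rw [card_cross hdisj, hS, hT, pow_zero, Nat.sub_zero, ← Real.exp_nat_mul, one_div,
      ← Real.exp_neg, mul_comm c]
    push_cast
    exact le_rfl
  · have hcard : ((pairTargets n s).card : ℝ) ≤ Real.exp (2 * s * L) := by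
      rw [show 2 * (s : ℝ) * L = s * L + s * L by ring, Real.exp_add]
      refine le_trans ?_ (mul_le_mul (card_powersetCard_le_exp hn s)
        (card_powersetCard_le_exp hn s) (by positivity) (by positivity))
      exact_mod_cast Finset.card_image_le.trans
        ((Finset.card_filter_le _ _).trans_eq (Finset.card_product _ _))
    rw [nsmul_eq_mul]
    refine (mul_le_mul_of_nonneg_right hcard (Real.exp_pos _).le).trans ?_
    rw [← Real.exp_add]
    exact Real.exp_le_exp.2 (by linarith)

end Targets

/-! ### Choice of Maker's parameters. -/

/-- Maker wins the diameter game if the parameters allow him to achieve expansion. -/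
theorem makerWinsDiameter_of_expansion {n d b j X Y : ℕ} {L c : ℝ} (hd : 2 * j + 3 ≤ d)
    (hn : (n : ℝ) = Real.exp L) (hjn : j + 2 < n) (hc0 : 0 ≤ c) (hcb : c * b ≤ 2 / 5)
    (hY : X * Y + 1 ≤ n) (hX : ∀ i < j, (X + 1) * (X ^ (i + 1) * Y) ≤ n)
    (hstar : 2 * L + (X * Y : ℕ) * (7 / 10) ≤ c * (n - ((X * Y : ℕ) + 1)))
    (hexp : ∀ i < j, ((X ^ (i + 1) * Y : ℕ) + (X ^ (i + 2) * Y : ℕ)) * L + L ≤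
      c * ((X ^ (i + 1) * Y : ℕ) * (n - ((X ^ (i + 1) * Y : ℕ) + (X ^ (i + 2) * Y : ℕ)))))
    (hpair : 2 * (X ^ (j + 1) * Y : ℕ) * L + L ≤
      c * ((X ^ (j + 1) * Y : ℕ) * (X ^ (j + 1) * Y : ℕ))) :
    MakerWinsDiameter d 1 b n := by
  set I := starTargets n (X * Y) ∪ ((Finset.range j).biUnion fun i =>
    expansionTargets n (X ^ (i + 1) * Y) (X ^ (i + 2) * Y)) ∪ pairTargets n (X ^ (j + 1) * Y)
    with hI
  refine makerWinsFrom_of_sum_weight_lt (I := I) (Real.one_le_exp hc0) ?_ ?_ ?_ ?_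
  · rw [← Real.exp_nat_mul, mul_comm]
    refine (Real.exp_le_exp.2 hcb).trans ?_
    -- `exp (2/5) ≤ 3/2` is checked on fifth powers, as `exp 1 ^ 2 ≤ (3/2) ^ 5`.
    refine le_of_pow_le_pow_left₀ (n := 5) (by norm_num) (by norm_num) ?_
    rw [← Real.exp_nat_mul, show ((5 : ℕ) : ℝ) * (2 / 5) = ((2 : ℕ) : ℝ) * 1 by norm_num,
      Real.exp_nat_mul]
    have := Real.exp_one_lt_d9
    calc Real.exp 1 ^ 2 ≤ 2.7182818286 ^ 2 := by gcongr
      _ ≤ _ := by norm_num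
  · intro F hF
    rw [hI, Finset.mem_union, Finset.mem_union, Finset.mem_biUnion] at hF
    rcases hF with (hF | ⟨i, -, hF⟩) | hF
    · obtain ⟨v, -, rfl⟩ := Finset.mem_image.1 hF
      exact cross_subset_completeBoard (by simp)
    · obtain ⟨p, -, rfl⟩ := Finset.mem_image.1 hF
      exact cross_subset_completeBoard
        (disjoint_compl_right.mono_left Finset.subset_union_left)
    · obtain ⟨p, hp, rfl⟩ := Finset.mem_image.1 hF
      exact cross_subset_completeBoard (Finset.mem_filter.1 hp).2
  · have hf : ∀ F : Finset (Sym2 (Fin n)) × ℕ,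
        0 ≤ (2 : ℝ) ^ F.2 / Real.exp c ^ (F.1.card - F.2) := fun F => by positivity
    have h1 := sum_starTargets_le hn hY hstar
    have h2 := sum_biUnion_le_card_mul hf (Finset.range j) (fun i =>
      expansionTargets n (X ^ (i + 1) * Y) (X ^ (i + 2) * Y)) (c := Real.exp (-L)) fun i hi =>
      sum_expansionTargets_le hn hc0 (hexp i (Finset.mem_range.1 hi))
    have h3 := sum_pairTargets_le hn hpair
    have h4 := sum_union_le_add hf (starTargets n (X * Y) ∪ ((Finset.range j).biUnion fun i =>
      expansionTargets n (X ^ (i + 1) * Y) (X ^ (i + 2) * Y))) (pairTargets n (X ^ (j + 1) * Y))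
    have h5 := sum_union_le_add hf (starTargets n (X * Y)) ((Finset.range j).biUnion fun i =>
      expansionTargets n (X ^ (i + 1) * Y) (X ^ (i + 2) * Y))
    rw [Finset.card_range] at h2
    -- The stars, the `j` expansion families and the pairs contribute at most `1 / n` each.
    have h6 : (j + 2 : ℝ) * Real.exp (-L) < 1 := by
      rw [Real.exp_neg, ← hn, ← div_eq_mul_inv, div_lt_one (by exact_mod_cast (by omega))]
      exact_mod_cast hjn
    linarith
  · intro M _ hM
    rw [diamAtMost_iff_forall_reach]
    intro x y
    refine (reach_of_expansion (X := X) (L := Y) (k := j) ?_ ?_ ?_ ?_ x y).mono hd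
    · simpa using hX
    · intro v
      exact hM (cross {v} {v}ᶜ, X * Y) (Finset.mem_union_left _ (Finset.mem_union_left _
        (Finset.mem_image.2 ⟨v, Finset.mem_univ _, rfl⟩)))
    · intro i hi S W hS hW
      rw [← Finset.card_pos]
      refine hM (cross S (S ∪ W)ᶜ, 0) (Finset.mem_union_left _ (Finset.mem_union_right _
        (Finset.mem_biUnion.2 ⟨i, Finset.mem_range.2 hi, Finset.mem_image.2 ⟨(S, W), ?_, rfl⟩⟩)))
      rw [Finset.mem_product, Finset.mem_powersetCard, Finset.mem_powersetCard]
      exact ⟨⟨Finset.subset_univ _, hS⟩, Finset.subset_univ _, hW⟩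
    · intro S T hdisj hS hT
      rw [← Finset.card_pos]
      refine hM (cross S T, 0) (Finset.mem_union_right _
        (Finset.mem_image.2 ⟨(S, T), ?_, rfl⟩))
      rw [Finset.mem_filter, Finset.mem_product, Finset.mem_powersetCard, Finset.mem_powersetCard]
      exact ⟨⟨⟨Finset.subset_univ _, hS⟩, Finset.subset_univ _, hT⟩, hdisj⟩

theorem makerWinsDiameter_of_large {n b d j : ℕ} {x L : ℝ} (hd : 2 * j + 3 ≤ d)
    (hL : (n : ℝ) = Real.exp L) (hx : (n : ℝ) = x ^ (j + 2) * L) (hjn : j + 2 < n)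
    (hL10 : 10 ≤ L) (hx20 : 20 ≤ x) (hxj : 10 * (11 / 10) ^ (j + 2) ≤ x)
    (hb : 6 * (b : ℝ) ≤ x ^ (j + 1)) : MakerWinsDiameter d 1 b n := by
  set X := ⌈x⌉₊
  set Y := ⌈L⌉₊
  have hx0 : 0 < x := by linarith
  have hL0 : 0 < L := by linarith
  have hX1 : x ≤ X := Nat.le_ceil x
  have hX2 : (X : ℝ) + 1 ≤ 11 / 10 * x := by
    have := Nat.ceil_lt_add_one hx0.le
    linarith
  have hY1 : L ≤ Y := Nat.le_ceil L
  have hY2 : (Y : ℝ) ≤ 11 / 10 * L := by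
    have := Nat.ceil_lt_add_one hL0.le
    linarith
  have hxp : 0 < x ^ (j + 1) := by positivity
  -- From `6 * b ≤ x ^ (j + 1)` comes `c * b ≤ 2/5`. The numerator must exceed `2`: two sets of size
  -- `s ≥ x ^ (j + 1) * L` give `n ^ (2 * s)` pairs against `c * s ^ 2 ≥ 12/5 * L * s`.
  set c := 12 / 5 / x ^ (j + 1) with hc
  have hc0 : 0 < c := by positivity
  have hcn : c * n = 12 / 5 * (x * L) := by
    rw [hx, hc, pow_succ x (j + 1)]
    field_simp
  -- Rounding `x` and `L` up costs at most a factor `(11/10) ^ (j + 2)`, which `hxj` absorbs;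
  -- complements of the sets used then keep `9/10` of the vertices.
  have hsmall : ∀ i ≤ j, ((X : ℝ) + 1) * ((X : ℝ) ^ i * Y) ≤ n / 10 := by
    intro i hi
    have h1 : (X : ℝ) ^ i ≤ (11 / 10 * x) ^ j :=
      (pow_le_pow_left₀ (by positivity) (by linarith) i).trans
        (pow_le_pow_right₀ (by linarith) hi)
    calc ((X : ℝ) + 1) * ((X : ℝ) ^ i * Y)
        ≤ (11 / 10 * x) * ((11 / 10 * x) ^ j * (11 / 10 * L)) := by gcongr
      _ = (11 / 10) ^ (j + 2) * (x ^ (j + 1) * L) := by rw [mul_pow]; ring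
      _ ≤ x / 10 * (x ^ (j + 1) * L) := by gcongr; linarith
      _ = n / 10 := by rw [hx]; ring
  have hstep : ∀ i, ((X ^ (i + 2) * Y : ℕ) : ℝ) = X * (X ^ (i + 1) * Y : ℕ) := fun i => by
    push_cast; ring
  have hXLs : ∀ i, L ≤ ((X ^ i * Y : ℕ) : ℝ) := fun i => by
    have : 1 ≤ (X : ℝ) ^ i := one_le_pow₀ (by linarith)
    push_cast
    nlinarith
  have hXY : ((X * Y : ℕ) : ℝ) + 1 ≤ n / 10 := by
    have h1 : (X : ℝ) * Y ≤ (11 / 10 * x) * (11 / 10 * L) := by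
      gcongr
      linarith
    have h2 : x ^ 2 * L ≤ n := by
      rw [hx]
      gcongr
      · linarith
      · omega
    push_cast
    nlinarith [mul_pos hx0 hL0, mul_le_mul hx20 hL10 (by norm_num) hx0.le]
  refine makerWinsDiameter_of_expansion (X := X) (Y := Y) hd hL hjn hc0.le ?_ ?_ ?_ ?_ ?_ ?_
  · rw [hc, div_mul_eq_mul_div, div_le_iff₀ hxp]
    linarith
  · have : ((X * Y + 1 : ℕ) : ℝ) ≤ n := by
      push_cast at hXY ⊢
      linarith [Nat.cast_nonneg (α := ℝ) n]
    exact_mod_cast this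
  · intro i hi
    have h := hsmall (i + 1) hi
    have : (((X + 1) * (X ^ (i + 1) * Y) : ℕ) : ℝ) ≤ n := by
      push_cast
      linarith [Nat.cast_nonneg (α := ℝ) n]
    exact_mod_cast this
  · have h1 : c * (n * (9 / 10)) ≤ c * (n - (((X * Y : ℕ) : ℝ) + 1)) := by
      gcongr
      linarith
    have h2 : ((X * Y : ℕ) : ℝ) ≤ (11 / 10 * x) * (11 / 10 * L) := by
      push_cast
      gcongr
      linarith
    have h3 : 20 * L ≤ x * L := by gcongr
    linarith
  · intro i hi
    have h := hsmall (i + 1) hi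
    rw [hstep]
    have h0 := hXLs (i + 1)
    push_cast at h0 ⊢
    set t : ℝ := (X : ℝ) ^ (i + 1) * Y
    have ht : 0 < t := by linarith
    have h1 : c * (t * (n * (9 / 10))) ≤ c * (t * (n - (t + X * t))) := by
      gcongr
      linarith
    have h2 : (t + X * t) * L ≤ 11 / 10 * x * t * L := by
      gcongr
      nlinarith
    have h3 : L ≤ x * t * L := by
      have : 1 ≤ x * t := by nlinarith
      nlinarith
    have h4 : c * (t * (n * (9 / 10))) = 12 / 5 * (x * L) * t * (9 / 10) := by
      rw [← hcn]; ring
    nlinarith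
  · have h0 := hXLs (j + 1)
    have h1 : x ^ (j + 1) * L ≤ ((X ^ (j + 1) * Y : ℕ) : ℝ) := by
      push_cast
      gcongr
    set s : ℝ := ((X ^ (j + 1) * Y : ℕ) : ℝ)
    have h2 : 12 / 5 * L ≤ c * s := by
      calc 12 / 5 * L = c * (x ^ (j + 1) * L) := by rw [hc]; field_simp
        _ ≤ c * s := by gcongr
    have h3 : 12 / 5 * L * s ≤ c * s * s := by
      gcongr
    nlinarith

open Filter in
theorem tendsto_natCast_div_log_atTop :
    Tendsto (fun n : ℕ => (n : ℝ) / Real.log n) atTop atTop := by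
  have h : Tendsto (fun n : ℕ => (n : ℝ) ^ (1 / 2 : ℝ) / 2) atTop atTop :=
    ((tendsto_rpow_atTop (by norm_num)).comp tendsto_natCast_atTop_atTop).atTop_div_const
      (by norm_num)
  refine tendsto_atTop_mono' _ ?_ h
  filter_upwards [eventually_ge_atTop 2] with n hn
  have hn' : (2 : ℝ) ≤ n := by exact_mod_cast hn
  have hlog : 0 < Real.log n := Real.log_pos (by linarith)
  rw [← Real.sqrt_eq_rpow, le_div_iff₀ hlog]
  -- `log n = 2 * log √n`.
  have h1 : Real.log n ≤ 2 * √n := by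
    have h2 := Real.log_le_self (Real.sqrt_nonneg (n : ℝ))
    rw [Real.log_sqrt (by linarith)] at h2
    linarith
  have h3 := Real.mul_self_sqrt (show (0 : ℝ) ≤ n by linarith)
  nlinarith [Real.sqrt_nonneg (n : ℝ)]

open Filter in
theorem makerWinsDiameter_eventually {d j : ℕ} (hd : 2 * j + 3 ≤ d) :
    ∃ N : ℕ, ∀ n : ℕ, N ≤ n → MakerWinsDiameter d 1
      ⌊(2 * (d : ℝ))⁻¹ * ((n : ℝ) / Real.log n) ^ (1 - 1 / ((j + 2 : ℕ) : ℝ))⌋₊ n := by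
  have hx : Tendsto (fun n : ℕ => ((n : ℝ) / Real.log n) ^ (1 / ((j + 2 : ℕ) : ℝ))) atTop atTop :=
    (tendsto_rpow_atTop (by positivity)).comp tendsto_natCast_div_log_atTop
  have hlog : Tendsto (fun n : ℕ => Real.log n) atTop atTop :=
    Real.tendsto_log_atTop.comp tendsto_natCast_atTop_atTop
  refine eventually_atTop.1 ?_
  filter_upwards [hx.eventually_ge_atTop 20, hx.eventually_ge_atTop (10 * (11 / 10) ^ (j + 2)),
    hlog.eventually_ge_atTop 10, eventually_gt_atTop (j + 2)] with n h20 hj h10 hn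
  have hn0 : (0 : ℝ) < n := by exact_mod_cast (by omega : 0 < n)
  have hz : 0 ≤ (n : ℝ) / Real.log n := by positivity
  refine makerWinsDiameter_of_large (L := Real.log n) hd (Real.exp_log hn0).symm ?_ hn h10 h20 hj ?_
  · rw [rpow_one_div_pow_self hz (by omega)]
    field_simp
  · rw [rpow_one_sub_one_div hz]
    set w := (((n : ℝ) / Real.log n) ^ (1 / ((j + 1 + 1 : ℕ) : ℝ))) ^ (j + 1)
    have hw : 0 ≤ w := by positivity
    have hd' : (3 : ℝ) ≤ d := by exact_mod_cast (by omega : 3 ≤ d)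
    -- The bias needs only the constant `1/6`, and `d ≥ 3`.
    have h1 : (2 * (d : ℝ))⁻¹ ≤ 6⁻¹ := by
      gcongr
      linarith
    have h2 := Nat.floor_le (a := (2 * (d : ℝ))⁻¹ * w) (by positivity)
    nlinarith

end MakerBreaker

theorem mainTheorem2 (d : ℕ) (hd : 3 ≤ d) :
    (∃ N : ℕ, ∀ n : ℕ, N ≤ n →
      MakerBreaker.MakerWinsDiameter d 1
        ⌊(2 * (d : ℝ))⁻¹ * ((n : ℝ) / Real.log n) ^ (1 - 1 / (⌈(d : ℝ) / 2⌉₊ : ℝ))⌋₊ n) ∧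
    (∃ c₂ : ℝ, 0 < c₂ ∧ ∃ N : ℕ, ∀ n : ℕ, N ≤ n →
      MakerBreaker.BreakerWinsDiameter d 1
        ⌊c₂ * (n : ℝ) ^ (1 - 1 / ((d : ℝ) - 1))⌋₊ n) ∧
    (∀ a : ℕ, 1 < a → ∃ c₃ : ℝ, 0 < c₃ ∧ ∃ N : ℕ, ∀ n : ℕ, N ≤ n →
      MakerBreaker.BreakerWinsDiameter d a
        ⌊c₃ * (n : ℝ) ^ (1 - 1 / (d : ℝ))⌋₊ n) := by
  have hd' : (3 : ℝ) ≤ d := by exact_mod_cast hd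
  refine ⟨?_, ?_, fun a ha =>
    MakerBreaker.breakerWinsDiameter_eventually (by omega) (by omega)⟩
  · have h1 : 1 < ⌈(d : ℝ) / 2⌉₊ := by
      rw [Nat.lt_ceil]
      push_cast
      linarith
    -- With `⌈d / 2⌉ = j + 2` this says `2 * j + 3 ≤ d`, an equality for odd `d`.
    have h2 : 2 * ⌈(d : ℝ) / 2⌉₊ < d + 2 := by
      have := Nat.ceil_lt_add_one (a := (d : ℝ) / 2) (by positivity)
      have h : (2 * ⌈(d : ℝ) / 2⌉₊ : ℝ) < d + 2 := by linarith
      exact_mod_cast h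
    obtain ⟨j, hj⟩ : ∃ j, ⌈(d : ℝ) / 2⌉₊ = j + 2 := ⟨_, (Nat.sub_add_cancel h1).symm⟩
    rw [hj] at h2 ⊢
    exact MakerBreaker.makerWinsDiameter_eventually (by omega)
  · obtain ⟨r, rfl⟩ : ∃ r, d = r + 2 := ⟨d - 2, by omega⟩
    have h := MakerBreaker.breakerWinsDiameter_one_eventually r
    rwa [show ((r + 1 : ℕ) : ℝ) = ((r + 2 : ℕ) : ℝ) - 1 by push_cast; ring] at h
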